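/- Let $0<\alpha<1$. For $x\in\mathbb{R}^N$ let $Dx\in\mathbb{R}^{N-1}$ be the finite difference, $(Dx)_i=x_{i+1}-x_i$ for $1\le i\le N-1$, and for $\mathcal{K}\subseteq\{1,\dots,N-1\}$ let $\|(Dx)_{\mathcal{K}}\|_1=\sum_{i\in\mathcal{K}}|(Dx)_i|$ and $\mathcal{K}^c=\{1,\dots,N-1\}\setminus\mathcal{K}$. There exist constants $\delta>0$ and $c>0$, depending only on $\alpha$, such that the following holds. Let $(M_k)_{k}$ and $(N_k)_{k}$ be sequences of natural numbers with $M_k\to\infty$, $N_k\to\infty$ and $M_k/N_k\to\alpha$, and for each $k$ let $A=A^{(k)}$ be an $M_k\times N_k$ random matrix with i.i.d. standard Gaussian $\mathcal{N}(0,1)$ entries. Then, for all sufficiently large $k$, with probability at least $1-e^{-cN_k}$ both of the following statements are true (with $N=N_k$). 1. For every $\mathcal{K}\subseteq\{1,\dots,N-1\}$ with $|\mathcal{K}|\le\delta N$ and every nonzero $x\in\mathbb{R}^N$ with $Ax=0$, $$\|(Dx)_{\mathcal{K}}\|_1<\|(Dx)_{\mathcal{K}^c}\|_1 .$$ 2.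 For every $x\in\mathbb{R}^N$ such that $Dx$ has at most $\delta N$ nonzero entries, $x$ is the unique solution of the one-dimensional total variation minimization problem $$\min_{z\in\mathbb{R}^N}\|Dz\|_1\quad\text{subject to}\quad Az=Ax .$$ -/

import Mathlib

open MeasureTheory ProbabilityTheory Filter Topology

/-- The law of an `M × N` random matrix with i.i.d. standard Gaussian entries, as a measure on
arrays of entries. -/
noncomputable def gaussianMatrix (M N : ℕ) : Measure (Fin M → Fin N → ℝ) :=
  Measure.pi fun _ : Fin M => Measure.pi fun _ : Fin N => gaussianReal 0 1

/-- The finite difference `D x ∈ ℝ^(N-1)` of `x ∈ ℝ^N`, with entries `x_{i+1} - x_i`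
(indices start at `0`). -/
def finiteDiff {N : ℕ} (x : Fin N → ℝ) : Fin (N - 1) → ℝ :=
  fun i => x ⟨i.1 + 1, by omega⟩ - x ⟨i.1, by omega⟩

/-- The norm `‖v_K‖₁` of the restriction of `v` to the index set `K`. -/
def l1NormOn {n : ℕ} (K : Finset (Fin n)) (v : Fin n → ℝ) : ℝ :=
  ∑ i ∈ K, |v i|

/-- The total variation `‖D x‖₁`. -/
def totalVariation {N : ℕ} (x : Fin N → ℝ) : ℝ :=
  l1NormOn Finset.univ (finiteDiff x)

/-- The null space condition for total variation minimization at the sparsity level `s`. -/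
def TVNullSpaceCondition {M N : ℕ} (A : Matrix (Fin M) (Fin N) ℝ) (s : ℝ) : Prop :=
  ∀ K : Finset (Fin (N - 1)), (K.card : ℝ) ≤ s →
    ∀ x : Fin N → ℝ, A.mulVec x = 0 → x ≠ 0 →
      l1NormOn K (finiteDiff x) < l1NormOn Kᶜ (finiteDiff x)

/-- `x` is the unique solution of: minimize `‖D z‖₁` subject to `A z = y`. -/
def IsUniqueTVSolution {M N : ℕ} (A : Matrix (Fin M) (Fin N) ℝ) (y : Fin M → ℝ)
    (x : Fin N → ℝ) : Prop :=
  A.mulVec x = y ∧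
    ∀ z : Fin N → ℝ, A.mulVec z = y → z ≠ x → totalVariation x < totalVariation z

/-- Total variation minimization recovers, from its measurements `A x`, every signal `x` whose
finite difference has at most `s` nonzero entries. -/
def TVRecoversAll {M N : ℕ} (A : Matrix (Fin M) (Fin N) ℝ) (s : ℝ) : Prop :=
  ∀ x : Fin N → ℝ, ({i | finiteDiff x i ≠ 0}.ncard : ℝ) ≤ s →
    IsUniqueTVSolution A (A.mulVec x) x

/-!
Uniform recovery follows deterministically from the null space condition, so it is enough to
exclude kernel vectors `x ≠ 0` that violate the null space inequality for some `K` with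
`|K| ≤ δ N`. By Cauchy–Schwarz such an `x` satisfies
`‖D x‖₁ ≤ 2 ‖(D x)_K‖₁ ≤ 4 √(δ N) ‖x‖₂`, a condition in which `K` no longer appears
(`totalVariation_le_of_l1NormOn_compl_le`).

Scale `x` to `‖x‖₂ = L √N` with a large constant `L`. Rounding the entries one after the other,
each towards the previous rounded value, gives integers `q` with `|x_i - q_i| ≤ 1` whose variation
does not exceed that of `x`, when the first entry is counted as a jump from `0`
(`exists_partialSums_approx`). Thus `q` is the sequence of partial sums
of an integer vector of `ℓ¹` norm at most `ρ N`, where `ρ` is small if `δ` is, and there are only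
`exp (κ N)` such vectors, with `κ → 0` as `ρ → 0` (`card_integerL1Ball_mul_pow_le`). For a fixed
`q`, Chernoff's inequality gives `‖A q‖ ≥ √M / 2 * ‖q‖` outside an event of probability
`exp (-M / 4)`, and a union bound makes this hold for all these `q` at once. The same counting of
integer vectors, with `ρ = 2`, shows `‖A‖ ≤ 10 √N` outside an event of probability `exp (-N)`
(`norm_euclideanCLM_le`). As `A x = 0`, it follows that
`√M / 2 * (L - 1) √N ≤ ‖A q‖ = ‖A (q - x)‖ ≤ 10 √N * √N`, which is false once `L` is large
compared with `√(N / M)` (`tvNullSpaceCondition_of_bounds`).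
-/

/-! ### Tails of `‖A u‖` for a fixed vector `u` -/

lemma integral_exp_mul_sq_gaussianReal {s : ℝ} (hs : s < 1 / 2) :
    ∫ x, Real.exp (s * x ^ 2) ∂(gaussianReal 0 1) = (√(1 - 2 * s))⁻¹ := by
  rw [integral_gaussianReal_eq_integral_smul one_ne_zero]
  have h1 : ∀ x : ℝ, gaussianPDFReal 0 1 x • Real.exp (s * x ^ 2)
      = (√(2 * Real.pi))⁻¹ * Real.exp (-(1 / 2 - s) * x ^ 2) := by
    intro x
    rw [gaussianPDFReal_def, smul_eq_mul, mul_assoc, ← Real.exp_add]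
    simp only [NNReal.coe_one, mul_one]
    congr 2
    ring
  simp_rw [h1]
  rw [integral_const_mul, integral_gaussian, ← Real.sqrt_inv, ← Real.sqrt_inv,
    ← Real.sqrt_mul (by positivity)]
  congr 1
  have : 1 - 2 * s ≠ 0 := by linarith
  have : 1 / 2 - s ≠ 0 := by intro h; linarith
  have := Real.pi_ne_zero
  field_simp

/-- The standard Gaussian measure is rotation invariant: its one-dimensional marginal in a unit
direction is the standard Gaussian law. -/
lemma map_dotProduct_pi_gaussianReal {N : ℕ} {u : Fin N → ℝ} (hu : ‖WithLp.toLp 2 u‖ = 1) :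
    (Measure.pi fun _ : Fin N => gaussianReal 0 1).map (fun a => a ⬝ᵥ u) = gaussianReal 0 1 := by
  have h : (fun a : Fin N → ℝ => a ⬝ᵥ u)
      = (innerSL ℝ (WithLp.toLp 2 u) : EuclideanSpace ℝ (Fin N) → ℝ) ∘ (WithLp.toLp 2) := by
    ext a
    simp [PiLp.inner_apply, dotProduct]
  rw [h, ← Measure.map_map (by fun_prop) (by fun_prop), map_pi_eq_stdGaussian,
    IsGaussian.map_eq_gaussianReal, integral_strongDual_stdGaussian, variance_dual_stdGaussian,
    innerSL_apply_norm, hu]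
  simp

lemma integral_exp_mul_sum_sq_gaussianMatrix (M : ℕ) {N : ℕ} {u : Fin N → ℝ}
    (hu : ‖WithLp.toLp 2 u‖ = 1) {s : ℝ} (hs : s < 1 / 2) :
    ∫ A, Real.exp (s * ∑ i, (A i ⬝ᵥ u) ^ 2) ∂(gaussianMatrix M N) = (√(1 - 2 * s))⁻¹ ^ M := by
  have h := integral_fintype_prod_eq_pow (ι := Fin M)
    (μ := Measure.pi fun _ : Fin N => gaussianReal 0 1)
    (fun a : Fin N → ℝ => Real.exp (s * (a ⬝ᵥ u) ^ 2))
  have h2 : ∫ a : Fin N → ℝ, Real.exp (s * (a ⬝ᵥ u) ^ 2)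
      ∂(Measure.pi fun _ : Fin N => gaussianReal 0 1) = (√(1 - 2 * s))⁻¹ := by
    have hm : Measurable fun a : Fin N → ℝ => a ⬝ᵥ u := by unfold dotProduct; fun_prop
    have h3 := integral_exp_mul_sq_gaussianReal hs
    rwa [← map_dotProduct_pi_gaussianReal hu, integral_map hm.aemeasurable (by fun_prop)] at h3
  rw [h2, Fintype.card_fin] at h
  rw [← h]
  simp_rw [Finset.mul_sum, Real.exp_sum]
  rfl

instance (M N : ℕ) : IsProbabilityMeasure (gaussianMatrix M N) := by
  unfold gaussianMatrix; infer_instance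

/-- Exponential Markov inequality for `s * ‖A u‖²`, with `s` of either sign, for `u` on the unit
sphere. -/
lemma gaussianMatrix_chernoff (M : ℕ) {N : ℕ} {u : Fin N → ℝ} (hu : ‖WithLp.toLp 2 u‖ = 1)
    {s : ℝ} (hs : s < 1 / 2) (ε : ℝ) :
    (gaussianMatrix M N).real {A | ε ≤ s * ∑ i, (A i ⬝ᵥ u) ^ 2}
      ≤ Real.exp (-ε) * (√(1 - 2 * s))⁻¹ ^ M := by
  have hI := integral_exp_mul_sum_sq_gaussianMatrix M hu hs
  have hpos : 0 < (√(1 - 2 * s))⁻¹ ^ M := by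
    have : 0 < 1 - 2 * s := by linarith
    positivity
  have := measure_ge_le_exp_mul_mgf (μ := gaussianMatrix M N)
    (X := fun A => s * ∑ i, (A i ⬝ᵥ u) ^ 2) (t := 1) ε zero_le_one
    (by simp only [one_mul]; exact Integrable.of_integral_ne_zero (by rw [hI]; exact hpos.ne'))
  simpa [mgf, hI] using this

lemma sum_sq_dotProduct_smul {M N : ℕ} (A : Fin M → Fin N → ℝ) (c : ℝ) (u : Fin N → ℝ) :
    ∑ i, (A i ⬝ᵥ (c • u)) ^ 2 = c ^ 2 * ∑ i, (A i ⬝ᵥ u) ^ 2 := by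
  simp [Finset.mul_sum, mul_pow]

/-- Chernoff bound for the lower tail, from the moment generating function at `-1`. -/
lemma gaussianMatrix_measureReal_sum_sq_lt_le (M : ℕ) {N : ℕ} (u : Fin N → ℝ) :
    (gaussianMatrix M N).real {A | ∑ i, (A i ⬝ᵥ u) ^ 2 < M / 4 * ‖WithLp.toLp 2 u‖ ^ 2}
      ≤ Real.exp (-(M / 4)) := by
  by_cases hu : ‖WithLp.toLp 2 u‖ = 0
  · have : {A : Fin M → Fin N → ℝ | ∑ i, (A i ⬝ᵥ u) ^ 2 < M / 4 * ‖WithLp.toLp 2 u‖ ^ 2} = ∅ := by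
      ext A
      simp only [hu, Set.mem_ofPred_eq, Set.mem_empty_iff_false, iff_false, not_lt]
      simp only [ne_eq, OfNat.ofNat_ne_zero, not_false_eq_true, zero_pow, mul_zero]
      positivity
    rw [this]
    simp [Real.exp_nonneg]
  set n := ‖WithLp.toLp 2 u‖ with hn
  have hn0 : 0 < n := lt_of_le_of_ne (norm_nonneg _) (Ne.symm hu)
  have h1 : ‖WithLp.toLp 2 (n⁻¹ • u)‖ = 1 := by
    rw [WithLp.toLp_smul, norm_smul, ← hn, norm_inv, Real.norm_of_nonneg hn0.le,
      inv_mul_cancel₀ hu]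
  have h2 := gaussianMatrix_chernoff M h1 (s := -1) (by norm_num) (-(M / 4))
  refine (measureReal_mono ?_).trans (h2.trans ?_)
  · intro A hA
    simp only [Set.mem_ofPred_eq, sum_sq_dotProduct_smul] at hA ⊢
    have : n⁻¹ ^ 2 * ∑ i, (A i ⬝ᵥ u) ^ 2 ≤ n⁻¹ ^ 2 * (M / 4 * n ^ 2) := by gcongr
    have e : n⁻¹ ^ 2 * (M / 4 * n ^ 2) = M / 4 := by field_simp
    linarith
  · -- This is `e < 3`.
    have h3 : (√(1 - 2 * (-1 : ℝ)))⁻¹ ≤ Real.exp (-(1 / 2)) := by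
      rw [Real.exp_neg]
      refine inv_anti₀ (Real.exp_pos _) (Real.le_sqrt_of_sq_le ?_)
      rw [← Real.exp_nat_mul]
      have := Real.exp_one_lt_d9
      norm_num
      linarith
    calc _ ≤ Real.exp (-(-(M / 4))) * Real.exp (-(1 / 2)) ^ M := by gcongr
      _ = _ := by
        rw [← Real.exp_nat_mul, ← Real.exp_add]
        congr 1
        ring

/-- Chernoff bound for the upper tail, from the moment generating function at `1 / 4`. -/
lemma gaussianMatrix_measureReal_lt_sum_sq_le (M : ℕ) {N : ℕ} (u : Fin N → ℝ) (t : ℝ) :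
    (gaussianMatrix M N).real {A | t * ‖WithLp.toLp 2 u‖ ^ 2 < ∑ i, (A i ⬝ᵥ u) ^ 2}
      ≤ Real.exp (M - t / 4) := by
  by_cases hu : ‖WithLp.toLp 2 u‖ = 0
  · have : {A : Fin M → Fin N → ℝ | t * ‖WithLp.toLp 2 u‖ ^ 2 < ∑ i, (A i ⬝ᵥ u) ^ 2} = ∅ := by
      have h0 : u = 0 := by simpa using hu
      ext A
      simp [h0]
    rw [this]
    simp [Real.exp_nonneg]
  set n := ‖WithLp.toLp 2 u‖ with hn
  have hn0 : 0 < n := lt_of_le_of_ne (norm_nonneg _) (Ne.symm hu)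
  have h1 : ‖WithLp.toLp 2 (n⁻¹ • u)‖ = 1 := by
    rw [WithLp.toLp_smul, norm_smul, ← hn, norm_inv, Real.norm_of_nonneg hn0.le,
      inv_mul_cancel₀ hu]
  have h2 := gaussianMatrix_chernoff M h1 (s := 1 / 4) (by norm_num) (t / 4)
  refine (measureReal_mono ?_).trans (h2.trans ?_)
  · intro A hA
    simp only [Set.mem_ofPred_eq, sum_sq_dotProduct_smul] at hA ⊢
    have : n⁻¹ ^ 2 * (t * n ^ 2) ≤ n⁻¹ ^ 2 * ∑ i, (A i ⬝ᵥ u) ^ 2 := by gcongr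
    have e : n⁻¹ ^ 2 * (t * n ^ 2) = t := by field_simp
    linarith
  · have h3 : (√(1 - 2 * (1 / 4 : ℝ)))⁻¹ ≤ Real.exp 1 := by
      have h4 : (√(1 - 2 * (1 / 4 : ℝ)))⁻¹ ≤ 2 := by
        rw [inv_le_comm₀ (by norm_num) (by norm_num)]
        exact Real.le_sqrt_of_sq_le (by norm_num)
      have := Real.add_one_le_exp (1 : ℝ)
      linarith
    calc _ ≤ Real.exp (-(t / 4)) * Real.exp 1 ^ M := by gcongr
      _ = _ := by
        rw [← Real.exp_nat_mul, ← Real.exp_add]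
        congr 1
        ring

/-! ### Integer vectors in an `ℓ¹` ball -/

/-- The integer vectors of `ℓ¹` norm at most `m`. The box in the definition makes the set finite
and imposes no further restriction. -/
noncomputable def integerL1Ball (N m : ℕ) : Finset (Fin N → ℤ) :=
  (Fintype.piFinset fun _ => Finset.Icc (-(m : ℤ)) m).filter fun v => ∑ i, (v i).natAbs ≤ m

lemma mem_integerL1Ball {N m : ℕ} {v : Fin N → ℤ} :
    v ∈ integerL1Ball N m ↔ ∑ i, (v i).natAbs ≤ m := by
  simp only [integerL1Ball, Finset.mem_filter, Fintype.mem_piFinset, Finset.mem_Icc,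
    and_iff_right_iff_imp]
  intro h i
  have : (v i).natAbs ≤ ∑ i, (v i).natAbs :=
    Finset.single_le_sum (f := fun i => (v i).natAbs) (fun _ _ => Nat.zero_le _)
      (Finset.mem_univ i)
  omega

lemma mem_integerL1Ball_floor {N : ℕ} {R : ℝ} {v : Fin N → ℤ} (h : ∑ i, |(v i : ℝ)| ≤ R) :
    v ∈ integerL1Ball N ⌊R⌋₊ := by
  rw [mem_integerL1Ball]
  refine Nat.le_floor (le_trans (le_of_eq ?_) h)
  push_cast [Nat.cast_natAbs]
  rfl

lemma sum_Icc_pow_natAbs_le {r : ℝ} (hr0 : 0 ≤ r) (hr : r ≤ 1 / 2) (m : ℕ) :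
    ∑ k ∈ Finset.Icc (-(m : ℤ)) m, r ^ k.natAbs ≤ 1 + 4 * r := by
  suffices h : ∑ k ∈ Finset.Icc (-(m : ℤ)) m, r ^ k.natAbs ≤ 1 + 4 * r - 4 * r ^ (m + 1) by
    have : 0 ≤ r ^ (m + 1) := by positivity
    linarith
  induction m with
  | zero => simp
  | succ m ih =>
    have hS : Finset.Icc (-((m + 1 : ℕ) : ℤ)) (m + 1 : ℕ)
        = insert (-((m + 1 : ℕ) : ℤ)) (insert ((m + 1 : ℕ) : ℤ) (Finset.Icc (-(m : ℤ)) m)) := by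
      ext k
      simp only [Finset.mem_Icc, Finset.mem_insert]
      omega
    rw [hS, Finset.sum_insert (by simp only [Finset.mem_insert, Finset.mem_Icc]; omega),
      Finset.sum_insert (by simp only [Finset.mem_Icc]; omega), Int.natAbs_neg, Int.natAbs_natCast]
    have h1 : r ^ (m + 1 + 1) ≤ r ^ (m + 1) * (1 / 2) := by
      rw [pow_succ]; gcongr
    linarith

/-- The number of integer vectors in an `ℓ¹` ball, bounded by giving each vector `v` the weight
`r ^ (‖v‖₁ - m)`. If `r` is small and `m` is much
smaller than `N / log r⁻¹`, the resulting bound has a small exponential rate in `N`. -/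
lemma card_integerL1Ball_mul_pow_le (N m : ℕ) {r : ℝ} (hr0 : 0 < r) (hr : r ≤ 1 / 2) :
    (integerL1Ball N m).card * r ^ m ≤ Real.exp (4 * r * N) := by
  calc ((integerL1Ball N m).card : ℝ) * r ^ m = ∑ v ∈ integerL1Ball N m, r ^ m := by simp
    _ ≤ ∑ v ∈ integerL1Ball N m, r ^ ∑ i, (v i).natAbs :=
        Finset.sum_le_sum fun v hv =>
          pow_le_pow_of_le_one hr0.le (by linarith) (mem_integerL1Ball.1 hv)
    _ ≤ ∑ v ∈ Fintype.piFinset fun _ : Fin N => Finset.Icc (-(m : ℤ)) m,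
          r ^ ∑ i, (v i).natAbs :=
        Finset.sum_le_sum_of_subset_of_nonneg (Finset.filter_subset _ _)
          fun _ _ _ => by positivity
    _ = ∏ _i : Fin N, ∑ k ∈ Finset.Icc (-(m : ℤ)) m, r ^ k.natAbs := by
        rw [Finset.prod_univ_sum]
        exact Finset.sum_congr rfl fun v _ => (Finset.prod_pow_eq_pow_sum _ _ _).symm
    _ ≤ ∏ _i : Fin N, Real.exp (4 * r) :=
        Finset.prod_le_prod (fun _ _ => Finset.sum_nonneg fun _ _ => by positivity) fun _ _ =>
          (sum_Icc_pow_natAbs_le hr0.le hr m).trans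
            (by have := Real.add_one_le_exp (4 * r); linarith)
    _ = Real.exp (4 * r * N) := by
        rw [Finset.prod_const, Finset.card_univ, Fintype.card_fin, ← Real.exp_nat_mul, mul_comm]

/-! ### Rounding to integers without increasing the variation -/

/-- Rounding `t` towards the integer `q`. -/
lemma exists_int_between (q : ℤ) (t : ℝ) :
    ∃ p : ℤ, |(p : ℝ) - q| + |t - p| = |t - q| ∧ |t - p| ≤ 1 := by
  rcases le_total (q : ℝ) t with h | h
  · refine ⟨⌊t⌋, ?_⟩
    have h1 : (q : ℝ) ≤ ⌊t⌋ := by exact_mod_cast Int.le_floor.2 h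
    have h2 := Int.floor_le t
    have h3 := Int.lt_floor_add_one t
    rw [abs_of_nonneg (by linarith), abs_of_nonneg (by linarith), abs_of_nonneg (by linarith)]
    constructor <;> linarith
  · refine ⟨⌈t⌉, ?_⟩
    have h1 : (⌈t⌉ : ℝ) ≤ q := by exact_mod_cast Int.ceil_le.2 h
    have h2 := Int.le_ceil t
    have h3 := Int.ceil_lt_add_one t
    rw [abs_of_nonpos (by linarith), abs_of_nonpos (by linarith), abs_of_nonpos (by linarith)]
    constructor <;> linarith

/-- Each term of a real sequence is rounded towards the rounded value of the preceding term,
starting from `0`. The variation of the rounded sequence plus the current rounding error is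
nonincreasing relative to the variation of the original sequence. -/
lemma exists_int_partialSums_approx (y : ℕ → ℝ) :
    ∃ v : ℕ → ℤ, ∀ n, |y n - ∑ j ∈ Finset.range (n + 1), (v j : ℝ)| ≤ 1 ∧
      ∑ j ∈ Finset.range (n + 1), |(v j : ℝ)| ≤ |y 0| + ∑ j ∈ Finset.range n, |y (j + 1) - y j| := by
  choose p hp1 hp2 using exists_int_between
  obtain ⟨Q, hQ0, hQs⟩ : ∃ Q : ℕ → ℤ, Q 0 = p 0 (y 0) ∧ ∀ n, Q (n + 1) = p (Q n) (y (n + 1)) :=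
    ⟨fun n => Nat.rec (p 0 (y 0)) (fun k q => p q (y (k + 1))) n, rfl, fun _ => rfl⟩
  let v : ℕ → ℤ := fun n => match n with
    | 0 => Q 0
    | k + 1 => Q (k + 1) - Q k
  have hQ : ∀ n, ∑ j ∈ Finset.range (n + 1), (v j : ℝ) = (Q n : ℝ) := by
    intro n
    induction n with
    | zero => simp [v]
    | succ n ih => rw [Finset.sum_range_succ, ih]; simp [v]
  have hV : ∀ n, ∑ j ∈ Finset.range (n + 1), |(v j : ℝ)| + |y n - Q n|
      ≤ |y 0| + ∑ j ∈ Finset.range n, |y (j + 1) - y j| := by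
    intro n
    induction n with
    | zero => simpa [v, hQ0] using (hp1 0 (y 0)).le
    | succ n ih =>
      rw [Finset.sum_range_succ, Finset.sum_range_succ (fun j => |y (j + 1) - y j|)]
      have h1 : |(v (n + 1) : ℝ)| + |y (n + 1) - Q (n + 1)| = |y (n + 1) - Q n| := by
        have := hp1 (Q n) (y (n + 1))
        simpa [v, hQs] using this
      have h2 := abs_sub_le (y (n + 1)) (y n) (Q n : ℝ)
      linarith
  refine ⟨v, fun n => ⟨?_, ?_⟩⟩
  · rw [hQ]
    cases n with
    | zero => rw [hQ0]; exact hp2 0 (y 0)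
    | succ n => rw [hQs]; exact hp2 (Q n) (y (n + 1))
  · have := hV n
    have := abs_nonneg (y n - Q n)
    linarith

/-- The real vector with first entry `v 0` and successive differences given by the other entries
of `v`. -/
def partialSums {N : ℕ} (v : Fin N → ℤ) : Fin N → ℝ :=
  fun i => ∑ j ∈ Finset.Iic i, (v j : ℝ)

lemma exists_partialSums_approx {N : ℕ} (y : Fin N → ℝ) {R : ℝ}
    (hR : ‖WithLp.toLp 2 y‖ + totalVariation y ≤ R) :
    ∃ v ∈ integerL1Ball N ⌊R⌋₊, ∀ i, |y i - partialSums v i| ≤ 1 := by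
  rcases N with _ | n
  · exact ⟨0, by simp [mem_integerL1Ball], fun i => i.elim0⟩
  obtain ⟨v, hv⟩ := exists_int_partialSums_approx
    (fun j => if h : j < n + 1 then y ⟨j, h⟩ else 0)
  refine ⟨fun i => v i, mem_integerL1Ball_floor ?_, fun i => ?_⟩
  · rw [Fin.sum_univ_eq_sum_range (fun j => |(v j : ℝ)|) (n + 1)]
    refine ((hv n).2.trans ?_).trans hR
    have h0 : |y 0| ≤ ‖WithLp.toLp 2 y‖ := by
      simpa using PiLp.norm_apply_le (WithLp.toLp 2 y) 0
    refine add_le_add (by simpa using h0) (le_of_eq ?_)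
    rw [Finset.sum_range]
    unfold totalVariation l1NormOn finiteDiff
    refine Finset.sum_congr rfl fun i _ => ?_
    rw [dif_pos (by omega), dif_pos (by omega)]
  · have h := (hv i).1
    have h2 : partialSums (fun i : Fin (n + 1) => v i) i
        = ∑ j ∈ Finset.range (i + 1), (v j : ℝ) := by
      rw [Nat.range_succ_eq_Iic, ← Fin.map_valEmbedding_Iic, Finset.sum_map]
      rfl
    rw [h2]
    simpa only [i.isLt, dif_pos] using h

lemma norm_toLp_le_sqrt_of_abs_le_one {N : ℕ} {w : Fin N → ℝ} (hw : ∀ i, |w i| ≤ 1) :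
    ‖WithLp.toLp 2 w‖ ≤ √N := by
  rw [EuclideanSpace.norm_eq]
  refine Real.sqrt_le_sqrt ?_
  calc ∑ i, ‖w i‖ ^ 2 ≤ ∑ _i : Fin N, (1 : ℝ) :=
        Finset.sum_le_sum fun i _ => pow_le_one₀ (norm_nonneg _) (hw i)
    _ = N := by simp

lemma sum_abs_le_sqrt_mul_norm {ι : Type*} [Fintype ι] (K : Finset ι) (y : ι → ℝ) :
    ∑ i ∈ K, |y i| ≤ √K.card * ‖WithLp.toLp 2 y‖ := by
  rw [EuclideanSpace.norm_eq, ← Real.sqrt_mul (by positivity)]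
  refine Real.le_sqrt_of_sq_le ((sq_sum_le_card_mul_sum_sq (s := K)).trans ?_)
  refine mul_le_mul_of_nonneg_left ?_ (by positivity)
  simp only [Real.norm_eq_abs]
  exact Finset.sum_le_sum_of_subset_of_nonneg (Finset.subset_univ _) fun _ _ _ => by positivity

/-! ### Failure of the null space condition forces small total variation -/

lemma finiteDiff_smul {N : ℕ} (c : ℝ) (x : Fin N → ℝ) :
    finiteDiff (c • x) = c • finiteDiff x := by
  ext i; simp [finiteDiff, mul_sub]

lemma totalVariation_smul {N : ℕ} (c : ℝ) (x : Fin N → ℝ) :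
    totalVariation (c • x) = |c| * totalVariation x := by
  simp [totalVariation, l1NormOn, finiteDiff_smul, abs_mul, Finset.mul_sum]

lemma norm_finiteDiff_le {N : ℕ} (x : Fin N → ℝ) :
    ‖WithLp.toLp 2 (finiteDiff x)‖ ≤ 2 * ‖WithLp.toLp 2 x‖ := by
  rcases N with _ | n
  · have h0 : finiteDiff x = 0 := funext fun i => Fin.elim0 i
    simp [h0]
  refine le_of_sq_le_sq ?_ (by positivity)
  rw [mul_pow, EuclideanSpace.norm_sq_eq, EuclideanSpace.norm_sq_eq]
  simp only [Real.norm_eq_abs, sq_abs]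
  have h1 : ∑ i, x i ^ 2 = x 0 ^ 2 + ∑ i : Fin n, x i.succ ^ 2 := Fin.sum_univ_succ _
  have h2 : ∑ i, x i ^ 2 = ∑ i : Fin n, x i.castSucc ^ 2 + x (Fin.last n) ^ 2 :=
    Fin.sum_univ_castSucc _
  have h3 : ∑ i, finiteDiff x i ^ 2 ≤ ∑ i : Fin n, (2 * x i.succ ^ 2 + 2 * x i.castSucc ^ 2) := by
    refine Finset.sum_le_sum fun (i : Fin n) _ => ?_
    have : finiteDiff x i = x i.succ - x i.castSucc := rfl
    rw [this]
    nlinarith [sq_nonneg (x i.succ + x i.castSucc)]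
  rw [Finset.sum_add_distrib, ← Finset.mul_sum, ← Finset.mul_sum] at h3
  have := sq_nonneg (x 0)
  have := sq_nonneg (x (Fin.last n))
  linarith

/-- A vector violating the null space inequality for `K` has small total variation, by a bound
that depends on `K` only through its cardinality. -/
lemma totalVariation_le_of_l1NormOn_compl_le {N : ℕ} {x : Fin N → ℝ} {K : Finset (Fin (N - 1))}
    (h : l1NormOn Kᶜ (finiteDiff x) ≤ l1NormOn K (finiteDiff x)) :
    totalVariation x ≤ 4 * √K.card * ‖WithLp.toLp 2 x‖ := by
  have h1 : totalVariation x = l1NormOn K (finiteDiff x) + l1NormOn Kᶜ (finiteDiff x) :=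
    (Finset.sum_add_sum_compl K _).symm
  have h2 : l1NormOn K (finiteDiff x) ≤ √K.card * (2 * ‖WithLp.toLp 2 x‖) :=
    (sum_abs_le_sqrt_mul_norm K _).trans (by gcongr; exact norm_finiteDiff_le x)
  linarith

/-- The null space condition implies uniform recovery, by the triangle inequality on and off the
support of the finite difference. -/
lemma TVNullSpaceCondition.tvRecoversAll {M N : ℕ} {A : Matrix (Fin M) (Fin N) ℝ} {s : ℝ}
    (hA : TVNullSpaceCondition A s) : TVRecoversAll A s := by
  classical
  intro x hx
  refine ⟨rfl, fun z hz hzx => ?_⟩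
  set K : Finset (Fin (N - 1)) := Finset.univ.filter fun i => finiteDiff x i ≠ 0 with hK
  have hKc : (K.card : ℝ) ≤ s := by
    have : {i | finiteDiff x i ≠ 0} = (K : Set (Fin (N - 1))) := by ext i; simp [hK]
    rwa [this, Set.ncard_coe_finset] at hx
  have h := hA K hKc (z - x) (by rw [Matrix.mulVec_sub, hz, sub_self]) (sub_ne_zero.2 hzx)
  have hD : ∀ i, finiteDiff (z - x) i = finiteDiff z i - finiteDiff x i := by
    intro i; simp only [finiteDiff, Pi.sub_apply]; ring
  have hx1 : totalVariation x = l1NormOn K (finiteDiff x) := by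
    refine (Finset.sum_subset (Finset.subset_univ K) fun i _ hi => ?_).symm
    simpa [hK] using hi
  have hz1 : totalVariation z = l1NormOn K (finiteDiff z) + l1NormOn Kᶜ (finiteDiff z) :=
    (Finset.sum_add_sum_compl K _).symm
  have h1 : l1NormOn K (finiteDiff x)
      ≤ l1NormOn K (finiteDiff z) + l1NormOn K (finiteDiff (z - x)) := by
    rw [l1NormOn, l1NormOn, l1NormOn, ← Finset.sum_add_distrib]
    refine Finset.sum_le_sum fun i _ => ?_
    have := abs_sub (finiteDiff z i) (finiteDiff (z - x) i)
    rw [hD] at this ⊢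
    simpa using this
  have h2 : l1NormOn Kᶜ (finiteDiff (z - x)) = l1NormOn Kᶜ (finiteDiff z) := by
    refine Finset.sum_congr rfl fun i hi => ?_
    have hi0 : finiteDiff x i = 0 := by simpa [hK] using hi
    rw [hD, hi0, sub_zero]
  linarith

/-! ### Bounds valid for every vector, from bounds on integer vectors -/

/-- The action of an array of entries between Euclidean spaces. -/
noncomputable def euclideanCLM {M N : ℕ} (A : Fin M → Fin N → ℝ) :
    EuclideanSpace ℝ (Fin N) →L[ℝ] EuclideanSpace ℝ (Fin M) :=
  LinearMap.toContinuousLinearMap (Matrix.toEuclideanLin (Matrix.of A))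

lemma norm_euclideanCLM_sq {M N : ℕ} (A : Fin M → Fin N → ℝ) (u : Fin N → ℝ) :
    ‖euclideanCLM A (WithLp.toLp 2 u)‖ ^ 2 = ∑ i, (A i ⬝ᵥ u) ^ 2 := by
  rw [EuclideanSpace.norm_sq_eq]
  simp [euclideanCLM, Matrix.mulVec]

lemma euclideanCLM_eq_zero {M N : ℕ} {A : Fin M → Fin N → ℝ} {u : Fin N → ℝ}
    (h : (Matrix.of A).mulVec u = 0) : euclideanCLM A (WithLp.toLp 2 u) = 0 := by
  simp [euclideanCLM, h]

/-- Integer vectors of `ℓ¹` norm at most `2 * N` control the operator norm: after scaling,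
rounding a vector to such an integer vector costs at most half of its length. -/
lemma norm_euclideanCLM_le {M N : ℕ} {A : Fin M → Fin N → ℝ} {B : ℝ} (hB : 0 ≤ B)
    (h : ∀ v ∈ integerL1Ball N (2 * N),
      ‖euclideanCLM A (WithLp.toLp 2 fun i => (v i : ℝ))‖
        ≤ B * ‖WithLp.toLp 2 fun i => (v i : ℝ)‖) :
    ‖euclideanCLM A‖ ≤ 2 * B := by
  set T := euclideanCLM A
  suffices hT : ‖T‖ ≤ B + ‖T‖ / 2 by linarith
  refine T.opNorm_le_bound (by positivity) fun x => ?_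
  rcases eq_or_ne x 0 with rfl | hx
  · simp
  have hx0 : 0 < ‖x‖ := norm_pos_iff.2 hx
  have hN : 0 < N := by
    rcases Nat.eq_zero_or_pos N with rfl | hN
    · exact absurd (Subsingleton.elim x 0) hx
    · exact hN
  have hsN : 0 < √(N : ℝ) := Real.sqrt_pos.2 (by exact_mod_cast hN)
  set c : ℝ := 2 * √N / ‖x‖ with hc
  have hc0 : 0 < c := by positivity
  set y : EuclideanSpace ℝ (Fin N) := c • x with hy
  have hyn : ‖y‖ = 2 * √N := by
    rw [hy, norm_smul, Real.norm_of_nonneg hc0.le, hc]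
    field_simp
  choose p hp1 hp2 using exists_int_between
  set v : Fin N → ℤ := fun i => p 0 (y i) with hv
  set q : EuclideanSpace ℝ (Fin N) := WithLp.toLp 2 fun i => (v i : ℝ) with hq
  have hle : ∀ i, |(v i : ℝ)| ≤ |y i| := fun i => by
    have h1 := hp1 0 (y i)
    have h2 := abs_nonneg (y i - p 0 (y i))
    simp only [Int.cast_zero, sub_zero] at h1
    simp only [hv]
    linarith
  have hqy : ‖q‖ ≤ ‖y‖ := by
    rw [EuclideanSpace.norm_eq, EuclideanSpace.norm_eq]
    refine Real.sqrt_le_sqrt (Finset.sum_le_sum fun i _ => ?_)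
    exact pow_le_pow_left₀ (norm_nonneg _) (hle i) 2
  have hmem : v ∈ integerL1Ball N (2 * N) := by
    have h1 : ∑ i, |(v i : ℝ)| ≤ ((2 * N : ℕ) : ℝ) := by
      have h2 := sum_abs_le_sqrt_mul_norm Finset.univ y.ofLp
      have h3 : ‖WithLp.toLp 2 y.ofLp‖ = 2 * √N := hyn
      rw [h3, Finset.card_univ, Fintype.card_fin] at h2
      refine (Finset.sum_le_sum fun i _ => hle i).trans (h2.trans (le_of_eq ?_))
      push_cast
      linear_combination 2 * Real.mul_self_sqrt (Nat.cast_nonneg (α := ℝ) N)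
    simpa only [Nat.floor_natCast] using mem_integerL1Ball_floor h1
  have hw : ‖y - q‖ ≤ √N :=
    norm_toLp_le_sqrt_of_abs_le_one (w := fun i => y i - v i) fun i => hp2 0 (y i)
  have hTy : ‖T y‖ ≤ (B + ‖T‖ / 2) * ‖y‖ := by
    calc ‖T y‖ = ‖T q + T (y - q)‖ := by rw [← map_add, add_sub_cancel]
      _ ≤ ‖T q‖ + ‖T (y - q)‖ := norm_add_le _ _
      _ ≤ B * ‖y‖ + ‖T‖ * √N := by
          refine add_le_add ((h v hmem).trans (by gcongr)) ((T.le_opNorm _).trans (by gcongr))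
      _ = _ := by rw [hyn]; ring
  rw [hy, map_smul, norm_smul, norm_smul, Real.norm_of_nonneg hc0.le, mul_left_comm] at hTy
  exact le_of_mul_le_mul_left hTy hc0

/-- The deterministic part of the argument. A kernel vector violating the null space inequality
is scaled to Euclidean norm `L * √N`. It then lies within `√N` of the partial sums `q` of an
integer vector of small `ℓ¹` norm, so that `‖A q‖` is at most `‖A‖ * √N`, while the lower bound
on `A q` makes it larger. -/
lemma tvNullSpaceCondition_of_bounds {M N : ℕ} {A : Fin M → Fin N → ℝ} {C L R δ : ℝ}
    (hL : 1 ≤ L) (hnorm : ‖euclideanCLM A‖ ≤ C)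
    (hlow : ∀ v ∈ integerL1Ball N ⌊R⌋₊,
      M / 4 * ‖WithLp.toLp 2 (partialSums v)‖ ^ 2
        ≤ ‖euclideanCLM A (WithLp.toLp 2 (partialSums v))‖ ^ 2)
    (hR : (1 + 4 * √(δ * N)) * (L * √N) ≤ R)
    (hCL : C ^ 2 < M / 4 * (L - 1) ^ 2) :
    TVNullSpaceCondition (Matrix.of A) (δ * N) := by
  intro K hK x hAx hx
  by_contra! hbad
  have hN : 0 < N := by
    rcases Nat.eq_zero_or_pos N with rfl | hN
    · exact absurd (Subsingleton.elim x 0) hx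
    · exact hN
  have hNR : (0 : ℝ) < N := by exact_mod_cast hN
  have hsN : 0 < √(N : ℝ) := Real.sqrt_pos.2 hNR
  have hC : 0 ≤ C := (norm_nonneg _).trans hnorm
  have hx0 : 0 < ‖WithLp.toLp 2 x‖ := norm_pos_iff.2 (by simpa using hx)
  set T := euclideanCLM A
  set c : ℝ := L * √N / ‖WithLp.toLp 2 x‖ with hc
  have hc0 : 0 < c := by positivity
  have hyn : ‖WithLp.toLp 2 (c • x)‖ = L * √N := by
    rw [WithLp.toLp_smul, norm_smul, Real.norm_of_nonneg hc0.le, hc]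
    field_simp
  have hTV : totalVariation (c • x) ≤ 4 * √(δ * N) * (L * √N) := by
    rw [totalVariation_smul, abs_of_pos hc0]
    calc c * totalVariation x ≤ c * (4 * √K.card * ‖WithLp.toLp 2 x‖) := by
          gcongr; exact totalVariation_le_of_l1NormOn_compl_le hbad
      _ = 4 * √K.card * (L * √N) := by rw [hc]; field_simp
      _ ≤ _ := by gcongr
  obtain ⟨v, hv, hvy⟩ := exists_partialSums_approx (c • x) (R := R) (by rw [hyn]; linarith)
  set y : EuclideanSpace ℝ (Fin N) := WithLp.toLp 2 (c • x)
  set q : EuclideanSpace ℝ (Fin N) := WithLp.toLp 2 (partialSums v)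
  have hw : ‖y - q‖ ≤ √N :=
    norm_toLp_le_sqrt_of_abs_le_one (w := fun i => (c • x) i - partialSums v i) hvy
  have hTy : T y = 0 := euclideanCLM_eq_zero (by rw [Matrix.mulVec_smul, hAx, smul_zero])
  have hTq : ‖T q‖ ≤ C * √N := by
    have : T q = -T (y - q) := by rw [map_sub, hTy, zero_sub, neg_neg]
    rw [this, norm_neg]
    exact (T.le_opNorm _).trans (by gcongr)
  have hq : (L - 1) * √N ≤ ‖q‖ := by
    have := norm_sub_norm_le y q
    rw [hyn] at this
    linarith
  have hq0 : 0 ≤ (L - 1) * √N := mul_nonneg (by linarith) hsN.le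
  have h1 : M / 4 * ((L - 1) * √N) ^ 2 ≤ (C * √N) ^ 2 := by
    calc (M : ℝ) / 4 * ((L - 1) * √N) ^ 2 ≤ M / 4 * ‖q‖ ^ 2 := by gcongr
      _ ≤ ‖T q‖ ^ 2 := hlow v hv
      _ ≤ _ := by gcongr
  rw [mul_pow, mul_pow, Real.sq_sqrt hNR.le, ← mul_assoc] at h1
  exact absurd (le_of_mul_le_mul_right h1 hNR) (not_le.2 hCL)

/-! ### Union bounds over integer vectors -/

lemma measureReal_exists_mem_integerL1Ball_le {Ω : Type*} [MeasurableSpace Ω] (μ : Measure Ω)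
    [IsProbabilityMeasure μ] {N m : ℕ} (E : (Fin N → ℤ) → Set Ω) {a r : ℝ}
    (hr0 : 0 < r) (hr : r ≤ 1 / 2) (hE : ∀ v, μ.real (E v) ≤ Real.exp a) :
    μ.real {ω | ∃ v ∈ integerL1Ball N m, ω ∈ E v}
      ≤ Real.exp (m * Real.log r⁻¹ + 4 * r * N + a) := by
  have h1 : {ω | ∃ v ∈ integerL1Ball N m, ω ∈ E v} = ⋃ v ∈ integerL1Ball N m, E v := by
    ext; simp
  have h2 : ((integerL1Ball N m).card : ℝ) ≤ Real.exp (m * Real.log r⁻¹ + 4 * r * N) := by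
    rw [Real.exp_add, Real.exp_nat_mul, Real.exp_log (inv_pos.2 hr0), inv_pow, ← div_eq_inv_mul,
      le_div_iff₀ (by positivity)]
    exact card_integerL1Ball_mul_pow_le N m hr0 hr
  calc _ ≤ ∑ v ∈ integerL1Ball N m, μ.real (E v) := by
        rw [h1]; exact measureReal_biUnion_finset_le _ _
    _ ≤ ∑ v ∈ integerL1Ball N m, Real.exp a := Finset.sum_le_sum fun v _ => hE v
    _ = (integerL1Ball N m).card * Real.exp a := by simp
    _ ≤ _ := by rw [Real.exp_add _ a]; gcongr

lemma gaussianMatrix_measureReal_norm_gt_le {M N : ℕ} (hMN : M ≤ N) :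
    (gaussianMatrix M N).real {A | 10 * √N < ‖euclideanCLM A‖} ≤ Real.exp (-N) := by
  have h := measureReal_exists_mem_integerL1Ball_le (gaussianMatrix M N) (N := N) (m := 2 * N)
    (fun v => {A | 25 * N * ‖WithLp.toLp 2 fun i => (v i : ℝ)‖ ^ 2
      < ∑ i, (A i ⬝ᵥ fun i => (v i : ℝ)) ^ 2})
    (r := 1 / 2) (by norm_num) le_rfl
    (fun v => gaussianMatrix_measureReal_lt_sum_sq_le M _ (25 * N))
  refine (measureReal_mono ?_).trans (h.trans (Real.exp_le_exp.2 ?_))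
  · intro A hA
    contrapose! hA
    simp only [Set.mem_ofPred_eq, not_exists, not_and, not_lt] at hA ⊢
    have := norm_euclideanCLM_le (A := A) (B := 5 * √N) (by positivity) fun v hv => by
      refine le_of_sq_le_sq ?_ (by positivity)
      rw [norm_euclideanCLM_sq, mul_pow, mul_pow, Real.sq_sqrt (by positivity)]
      refine (hA v hv).trans (le_of_eq ?_)
      ring
    linarith
  · -- The exponent is at most `(2 log 2 + 2 + 1 - 25 / 4) N`, and `2 log 2 ≤ 1.4`.
    have h2 : Real.log (1 / 2 : ℝ)⁻¹ ≤ 7 / 10 := by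
      have := Real.log_two_lt_d9
      norm_num
      linarith
    have h3 : (M : ℝ) ≤ N := by exact_mod_cast hMN
    have h4 : (0 : ℝ) ≤ N := by positivity
    have h5 := mul_le_mul_of_nonneg_left h2 h4
    push_cast
    linarith

lemma gaussianMatrix_measureReal_exists_partialSums_lt_le {M N m : ℕ} {r : ℝ} (hr0 : 0 < r)
    (hr : r ≤ 1 / 2) :
    (gaussianMatrix M N).real {A | ∃ v ∈ integerL1Ball N m,
        ‖euclideanCLM A (WithLp.toLp 2 (partialSums v))‖ ^ 2
          < M / 4 * ‖WithLp.toLp 2 (partialSums v)‖ ^ 2}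
      ≤ Real.exp (m * Real.log r⁻¹ + 4 * r * N - M / 4) := by
  simp only [norm_euclideanCLM_sq]
  exact measureReal_exists_mem_integerL1Ball_le (gaussianMatrix M N)
    (fun v => {A | ∑ i, (A i ⬝ᵥ partialSums v) ^ 2 < M / 4 * ‖WithLp.toLp 2 (partialSums v)‖ ^ 2})
    hr0 hr fun v => gaussianMatrix_measureReal_sum_sq_lt_le M (partialSums v)

/-! ### Choice of the parameters -/

theorem mainTheorem1 (α : ℝ) (hα0 : 0 < α) (hα1 : α < 1) :
    ∃ δ : ℝ, 0 < δ ∧ ∃ c : ℝ, 0 < c ∧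
      ∀ M N : ℕ → ℕ, Tendsto M atTop atTop → Tendsto N atTop atTop →
        Tendsto (fun k => (M k : ℝ) / (N k : ℝ)) atTop (𝓝 α) →
        ∀ᶠ k in atTop,
          gaussianMatrix (M k) (N k)
              {A | ¬ (TVNullSpaceCondition (Matrix.of A) (δ * N k) ∧
                TVRecoversAll (Matrix.of A) (δ * N k))}
            ≤ ENNReal.ofReal (Real.exp (-c * N k)) := by
  -- With `M ≥ α N / 2`, each lower tail event has probability at most `exp (-α N / 8)`. The
  -- parameters `r` and `ρ` make the number of integer vectors of `ℓ¹` norm at most `ρ N` no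
  -- larger than `exp (α N / 16)`; `L` makes the lower bound on `A q` beat `‖A‖ √N`, and `δ` makes
  -- the variation of a violating vector of norm `L √N` at most `ρ N / 2`.
  set r : ℝ := α / 128 with hr
  have hr0 : 0 < r := by positivity
  have hlog : 0 < Real.log r⁻¹ := Real.log_pos ((one_lt_inv₀ hr0).2 (by linarith))
  set ρ : ℝ := α / 32 / Real.log r⁻¹ with hρ
  have hρ0 : 0 < ρ := by positivity
  set L : ℝ := 1 + 30 / α with hL
  have hL1 : 1 ≤ L := by
    have : 0 < 30 / α := by positivity
    linarith
  set δ : ℝ := (ρ / (8 * L)) ^ 2 with hδ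
  have hδs : √δ = ρ / (8 * L) := Real.sqrt_sq (by positivity)
  refine ⟨δ, by positivity, α / 32, by positivity, fun M N hM hN hMN => ?_⟩
  have hNR : Tendsto (fun k => (N k : ℝ)) atTop atTop := tendsto_natCast_atTop_atTop.comp hN
  filter_upwards [hMN.eventually_const_lt (show α / 2 < α by linarith),
    hMN.eventually_lt_const hα1, hNR.eventually_ge_atTop ((2 * L / ρ) ^ 2),
    hNR.eventually_ge_atTop (32 / α)] with k h1 h2 h3 h4
  generalize M k = m at *
  generalize N k = n at *
  have hn0 : (0 : ℝ) < n := lt_of_lt_of_le (by positivity) h4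
  rw [lt_div_iff₀ hn0] at h1
  rw [div_lt_one hn0] at h2
  have hmn : m ≤ n := by exact_mod_cast h2.le
  have hsn : 2 * L / ρ ≤ √(n : ℝ) := Real.le_sqrt_of_sq_le h3
  have hss : √(n : ℝ) * √(n : ℝ) = n := Real.mul_self_sqrt hn0.le
  set E₁ : Set (Fin m → Fin n → ℝ) := {A | 10 * √n < ‖euclideanCLM A‖} with hE₁
  set E₂ : Set (Fin m → Fin n → ℝ) := {A | ∃ v ∈ integerL1Ball n ⌊ρ * n⌋₊,
      ‖euclideanCLM A (WithLp.toLp 2 (partialSums v))‖ ^ 2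
        < m / 4 * ‖WithLp.toLp 2 (partialSums v)‖ ^ 2} with hE₂
  have hsub : {A : Fin m → Fin n → ℝ | ¬ (TVNullSpaceCondition (Matrix.of A) (δ * n) ∧
      TVRecoversAll (Matrix.of A) (δ * n))} ⊆ E₁ ∪ E₂ := by
    intro A hA
    by_contra hA'
    simp only [hE₁, hE₂, Set.mem_union, Set.mem_ofPred_eq, not_or, not_lt, not_exists,
      not_and] at hA'
    have hns := tvNullSpaceCondition_of_bounds hL1 hA'.1 hA'.2 (δ := δ) (by
        rw [Real.sqrt_mul (by positivity), hδs]
        have e1 : L * √n ≤ ρ / 2 * n := by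
          rw [div_le_iff₀ hρ0] at hsn
          nlinarith [Real.sqrt_nonneg (n : ℝ)]
        have e2 : 4 * (ρ / (8 * L) * √n) * (L * √n) = ρ / 2 * n := by
          have : L ≠ 0 := by positivity
          calc 4 * (ρ / (8 * L) * √n) * (L * √n) = ρ / 2 * (√n * √n) := by
                field_simp
                ring
            _ = ρ / 2 * n := by rw [hss]
        linarith) (by
        rw [mul_pow, Real.sq_sqrt hn0.le]
        have e3 : m / 4 * (L - 1) ^ 2 = m * (225 / α ^ 2) := by
          rw [hL]
          field_simp
          ring
        have e4 : α / 2 * n * (225 / α ^ 2) ≤ m * (225 / α ^ 2) := by gcongr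
        have e5 : α / 2 * n * (225 / α ^ 2) = n * (112.5 / α) := by
          field_simp
          ring
        have e6 : 112.5 ≤ 112.5 / α := by
          rw [le_div_iff₀ hα0]
          linarith
        have e7 := mul_le_mul_of_nonneg_left e6 hn0.le
        linarith)
    exact hA ⟨hns, hns.tvRecoversAll⟩
  have hP₁ : (gaussianMatrix m n).real E₁ ≤ Real.exp (-(α / 16 * n)) :=
    (gaussianMatrix_measureReal_norm_gt_le hmn).trans (Real.exp_le_exp.2 (by nlinarith))
  have hP₂ : (gaussianMatrix m n).real E₂ ≤ Real.exp (-(α / 16 * n)) := by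
    refine (gaussianMatrix_measureReal_exists_partialSums_lt_le hr0 (by linarith)).trans
      (Real.exp_le_exp.2 ?_)
    have e1 : (⌊ρ * n⌋₊ : ℝ) * Real.log r⁻¹ ≤ ρ * n * Real.log r⁻¹ := by
      gcongr
      exact Nat.floor_le (by positivity)
    have e2 : ρ * n * Real.log r⁻¹ = α / 32 * n := by
      rw [mul_right_comm, hρ, div_mul_cancel₀ _ hlog.ne']
    have e3 : 4 * r * n = α / 32 * n := by
      rw [hr]
      ring
    linarith
  rw [ENNReal.le_ofReal_iff_toReal_le (measure_ne_top _ _) (Real.exp_nonneg _)]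
  calc (gaussianMatrix m n).real _ ≤ (gaussianMatrix m n).real (E₁ ∪ E₂) := measureReal_mono hsub
    _ ≤ (gaussianMatrix m n).real E₁ + (gaussianMatrix m n).real E₂ := measureReal_union_le _ _
    _ ≤ 2 * Real.exp (-(α / 16 * n)) := by linarith
    _ ≤ Real.exp (α / 32 * n) * Real.exp (-(α / 16 * n)) := by
        gcongr
        have e1 := Real.add_one_le_exp (α / 32 * n)
        have e2 : 1 ≤ α / 32 * n := by
          rw [div_le_iff₀ hα0] at h4
          linarith
        linarith
    _ = Real.exp (-(α / 32) * n) := by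
        rw [← Real.exp_add]
        congr 1
        ring
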